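/- Call a set $A\subset\mathbb R$ discrete closed if it has finitely many points in every bounded interval. There is a non-zero real, signed, locally finite Borel measure $\mu$ on $\mathbb R$ (in general of infinite total variation) with the following properties. The measure $\mu$ is pure point, $\mu=\sum_{\lambda\in\Lambda}\mu(\lambda)\,\delta_\lambda$ with $\mu(\lambda)\ne 0$ for all $\lambda\in\Lambda$; it is a temperate distribution; and its Fourier transform in the sense of distributions, defined by $\langle\hat\mu,\varphi\rangle=\langle\mu,\hat\varphi\rangle$ for Schwartz functions $\varphi$, where $\hat\varphi(t)=\int_{\mathbb R}\varphi(x)e^{-2\pi i t x}\,dx$, is also a (complex, locally finite) pure point measure, $\hat\mu=\sum_{s\in S}\hat\mu(s)\,\delta_s$ with $\hat\mu(s)\neq 0$ for all $s\in S$. Moreover: (i) the support $\Lambda$ and the spectrum $S$ are both discrete closed sets; (ii) $\Lambda$ contains only finitely many elements of any arithmetic progression $\{a+nd : n\in\mathbb Z\}$, $a,d\in\mathbb R$. In particular, $\Lambda$ is not contained in any finite union of translates of an arithmetic progression. (Every pure point measure which has a pure point Fourier transform, and whose support and spectrum are both uniformly discrete, does have its support contained in such a union, by an earlier theorem of the authors;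 so uniform discreteness cannot be relaxed to discreteness there.) -/

import Mathlib

open MeasureTheory SchwartzMap FourierTransform

/-- A complex, locally finite (possibly infinite) Borel measure on `ℝ`, given by its polar
decomposition `μ = u · |μ|`: the total variation `|μ|` is a locally finite positive measure,
and `u` is a measurable function of modulus one. -/
structure LocFinComplexMeasure where
  /-- The total variation measure `|μ|`. -/
  variation : Measure ℝ
  /-- The total variation is finite on a neighbourhood of every point. -/
  locFin : IsLocallyFiniteMeasure variation
  /-- The phase `u = dμ / d|μ|`. -/
  phase : ℝ → ℂ
  /-- The phase is measurable. -/
  measurable_phase : Measurable phase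
  /-- The phase has modulus one. -/
  norm_phase : ∀ x, ‖phase x‖ = 1

namespace LocFinComplexMeasure

/-- The integral `∫ f dμ`. -/
noncomputable def integral (μ : LocFinComplexMeasure) (f : ℝ → ℂ) : ℂ :=
  ∫ x, f x * μ.phase x ∂μ.variation

/-- The value `μ(E)`, for a bounded Borel set `E`. -/
noncomputable def value (μ : LocFinComplexMeasure) (E : Set ℝ) : ℂ :=
  ∫ x in E, μ.phase x ∂μ.variation

/-- `μ` is a real (signed) measure: `μ(E)` is real for every bounded Borel set `E`. -/
def IsReal (μ : LocFinComplexMeasure) : Prop :=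
  ∀ E : Set ℝ, MeasurableSet E → Bornology.IsBounded E → (μ.value E).im = 0

/-- The support of a pure point measure: the set of its non-zero atoms. -/
def atoms (μ : LocFinComplexMeasure) : Set ℝ :=
  {x | μ.value {x} ≠ 0}

/-- `μ` is a pure point measure, `μ = ∑_{x ∈ Λ} μ({x}) δ_x` with `Λ` the set of its atoms:
`Λ` is countable and `|μ|` does not charge the complement of `Λ`. -/
def IsPurePoint (μ : LocFinComplexMeasure) : Prop :=
  μ.atoms.Countable ∧ μ.variation μ.atomsᶜ = 0

/-- The temperate distribution `T` is the measure `μ`: they agree on compactly supported smooth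
functions. (These are dense in the Schwartz space, so `μ` determines `T`.) -/
def IsDistribution (μ : LocFinComplexMeasure) (T : 𝓢'(ℝ, ℂ)) : Prop :=
  ∀ f : 𝓢(ℝ, ℂ), HasCompactSupport f → T f = μ.integral f

end LocFinComplexMeasure

/-- A discrete closed subset of `ℝ`: it has finitely many points in every bounded interval. -/
def IsDiscreteClosed (A : Set ℝ) : Prop :=
  ∀ a b : ℝ, (A ∩ Set.Icc a b).Finite

/-- The (two-sided) arithmetic progression `{a + n d : n ∈ ℤ}`. -/
def arithProg (a d : ℝ) : Set ℝ :=
  Set.range fun n : ℤ => a + n * d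

/-!
Let `B` be a Blaschke factor and let `Φ` be the real function with `𝐞 (Φ x) = 𝐞 (θ x) B(𝐞 x)`, where
`θ > 0` is irrational. The measure `μ` has the mass `1 / Φ' x` at each solution `x` of
`Φ x ∈ c + ℤ`. Poisson summation in the variable `y = Φ x` gives
`μ.integral f = ∑ₙ 𝐞 (-n c) ∫ f(x) 𝐞 (n Φ x) dx`. For `n ≥ 0`, `𝐞 (n Φ x)` is `𝐞 (n θ x)` times a
power series in `𝐞 x`, and for `n < 0` it is the conjugate of such a function. Hence only the
frequencies `n θ + k` with `n k ≥ 0` occur, and these are discrete and closed although `θ` is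
irrational.

If infinitely many atoms lay in one arithmetic progression, some atom would be a rational convex
combination of two others. This is one of countably many analytic equations in `c`. If one of them
held identically, the derivative of `Φ⁻¹` would have a mean value property for two integer shifts,
and it is periodic with the irrational period `θ + 1`, so it would be constant by the maximum
principle. Hence every `c` outside a countable set works.
-/

open Filter Topology

theorem IsDiscreteClosed.finite_inter_of_isBounded {A s : Set ℝ} (hA : IsDiscreteClosed A)
    (hs : Bornology.IsBounded s) : (A ∩ s).Finite := by
  obtain ⟨R, hR⟩ := hs.subset_closedBall 0
  rw [Real.closedBall_eq_Icc] at hR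
  exact (hA _ _).subset (Set.inter_subset_inter_right A hR)

theorem IsDiscreteClosed.countable {A : Set ℝ} (hA : IsDiscreteClosed A) : A.Countable := by
  refine (Set.countable_iUnion fun n : ℕ =>
    (hA.finite_inter_of_isBounded (Metric.isBounded_closedBall (x := 0) (r := n))).countable).mono
      fun x hx => ?_
  obtain ⟨n, hn⟩ := exists_nat_ge |x|
  exact Set.mem_iUnion.2 ⟨n, hx, by simpa using hn⟩

theorem tsum_mul_extend_zero {ι : Type*} {x : ι → ℝ} (hx : Function.Injective x) (f : ℝ → ℂ)
    (w : ι → ℂ) : ∑' t, f t * Function.extend x w 0 t = ∑' i, f (x i) * w i := by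
  rw [← hx.tsum_eq]
  · simp only [hx.extend_apply]
  · refine (Function.support_mul_subset_right _ _).trans fun t ht => ?_
    by_contra h
    exact ht (Function.extend_apply' _ _ _ h)

namespace LocFinComplexMeasure

section OfAtoms

variable {w : ℝ → ℂ} (hw : IsDiscreteClosed (Function.support w))

theorem isLocallyFiniteMeasure_sum_smul_dirac {w : ℝ → ℂ}
    (hw : IsDiscreteClosed (Function.support w)) :
    IsLocallyFiniteMeasure (Measure.sum fun t => ‖w t‖ₑ • Measure.dirac t) := by
  refine ⟨fun x => ⟨Metric.ball x 1, Metric.ball_mem_nhds x one_pos, ?_⟩⟩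
  have hfin := hw.finite_inter_of_isBounded (Metric.isBounded_ball (x := x) (r := 1))
  rw [Measure.sum_apply _ measurableSet_ball, tsum_eq_sum (s := hfin.toFinset)]
  · refine ENNReal.sum_lt_top.2 fun t _ => ?_
    exact ENNReal.mul_lt_top enorm_lt_top (measure_lt_top _ _)
  · intro t ht
    simp only [Set.Finite.mem_toFinset, Set.mem_inter_iff, Function.mem_support, not_and_or,
      not_not] at ht
    rcases ht with ht | ht <;> simp [ht]

open Classical in
theorem measurable_ite_div_norm {w : ℝ → ℂ} (hw : IsDiscreteClosed (Function.support w)) :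
    Measurable fun t => if w t = 0 then 1 else w t / ‖w t‖ := by
  refine measurable_const.measurable_of_countable_ne (f := fun _ => (1 : ℂ))
    (hw.countable.mono fun t ht => ?_)
  by_contra h
  simp_all

open Classical in
/-- The pure point measure `∑ w(t) δ_t`, for weights `w` with discrete closed support. -/
noncomputable def ofAtoms : LocFinComplexMeasure where
  variation := Measure.sum fun t => ‖w t‖ₑ • Measure.dirac t
  locFin := isLocallyFiniteMeasure_sum_smul_dirac hw
  phase t := if w t = 0 then 1 else w t / ‖w t‖
  measurable_phase := measurable_ite_div_norm hw
  norm_phase t := by split_ifs with h <;> simp [h]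

theorem norm_mul_phase_ofAtoms (t : ℝ) : (‖w t‖ : ℂ) * (ofAtoms hw).phase t = w t := by
  by_cases h : w t = 0 <;> simp [ofAtoms, h, mul_div_cancel₀]

theorem variation_ofAtoms_apply {s : Set ℝ} (hs : MeasurableSet s) :
    (ofAtoms hw).variation s = ∑' t, ‖w t‖ₑ * s.indicator 1 t := by
  simp [ofAtoms, Measure.sum_apply _ hs, hs]

theorem variation_ofAtoms_singleton (t : ℝ) : (ofAtoms hw).variation {t} = ‖w t‖ₑ := by
  rw [variation_ofAtoms_apply hw (measurableSet_singleton t), tsum_eq_single t] <;> simp +contextual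

theorem value_ofAtoms_singleton (t : ℝ) : (ofAtoms hw).value {t} = w t := by
  rw [value, integral_singleton, Measure.real, variation_ofAtoms_singleton, toReal_enorm,
    Complex.real_smul, norm_mul_phase_ofAtoms]

theorem atoms_ofAtoms : (ofAtoms hw).atoms = Function.support w := by
  ext t
  rw [atoms, Set.mem_ofPred_eq, value_ofAtoms_singleton, Function.mem_support]

theorem isPurePoint_ofAtoms : (ofAtoms hw).IsPurePoint := by
  rw [IsPurePoint, atoms_ofAtoms, variation_ofAtoms_apply hw hw.countable.measurableSet.compl]
  exact ⟨hw.countable, by simp [ENNReal.tsum_eq_zero, or_iff_not_imp_left]⟩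

theorem variation_ofAtoms_ne_zero {t : ℝ} (ht : w t ≠ 0) : (ofAtoms hw).variation ≠ 0 := by
  intro h
  simpa [h, ht, eq_comm] using variation_ofAtoms_singleton hw t

theorem integral_ofAtoms {f : ℝ → ℂ} (hf : Integrable f (ofAtoms hw).variation) :
    (ofAtoms hw).integral f = ∑' t, f t * w t := by
  have hint : Integrable (fun t => f t * (ofAtoms hw).phase t) (ofAtoms hw).variation :=
    hf.mul_bdd (c := 1) (ofAtoms hw).measurable_phase.aestronglyMeasurable
      (.of_forall fun t => ((ofAtoms hw).norm_phase t).le)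
  refine (integral_sum_measure hint).trans (tsum_congr fun t => ?_)
  rw [integral_smul_measure, integral_dirac, toReal_enorm, Complex.real_smul, mul_left_comm,
    norm_mul_phase_ofAtoms]

theorem integral_ofAtoms_of_hasCompactSupport {f : ℝ → ℂ} (hf : Continuous f)
    (hc : HasCompactSupport f) : (ofAtoms hw).integral f = ∑' t, f t * w t :=
  have := (ofAtoms hw).locFin
  integral_ofAtoms hw (hf.integrable_of_hasCompactSupport hc)

theorem hasTemperateGrowth_variation_ofAtoms {n : ℕ}
    (h : Summable fun t : ℝ => ‖w t‖ * (1 + ‖t‖) ^ (-n : ℝ)) :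
    (ofAtoms hw).variation.HasTemperateGrowth := by
  have hpos : ∀ t : ℝ, 0 ≤ (1 + ‖t‖) ^ (-n : ℝ) := fun t => by positivity
  have hcont : Continuous fun t : ℝ => (1 + ‖t‖) ^ (-n : ℝ) :=
    Continuous.rpow_const (by fun_prop) fun t => .inl (by positivity)
  refine ⟨n, hcont.aestronglyMeasurable, (lintegral_sum_measure _ _).trans_lt ?_⟩
  refine lt_of_eq_of_lt (tsum_congr fun t => ?_) h.tsum_ofReal_lt_top
  rw [lintegral_smul_measure, lintegral_dirac, smul_eq_mul, ENNReal.ofReal_mul (norm_nonneg _),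
    ofReal_norm, Real.enorm_of_nonneg (hpos t)]

open scoped ComplexOrder in
theorem phase_ofAtoms_of_nonneg (h : ∀ t, 0 ≤ w t) (t : ℝ) : (ofAtoms hw).phase t = 1 := by
  by_cases ht : w t = 0
  · simp [ofAtoms, ht]
  · have hnorm := norm_mul_phase_ofAtoms hw t
    rw [← Complex.eq_coe_norm_of_nonneg (h t)] at hnorm
    exact mul_left_cancel₀ ht (hnorm.trans (mul_one _).symm)

end OfAtoms

section Positive

variable {μ : LocFinComplexMeasure} (hμ : ∀ x, μ.phase x = 1)
include hμ

theorem integral_of_phase_eq_one (f : ℝ → ℂ) : μ.integral f = ∫ x, f x ∂μ.variation := by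
  simp only [integral, hμ, mul_one]

theorem isReal_of_phase_eq_one : μ.IsReal := fun E _ _ => by
  simp [value, hμ]

theorem isDistribution_of_phase_eq_one [μ.variation.HasTemperateGrowth] :
    μ.IsDistribution μ.variation.toTemperedDistribution := fun f _ =>
  (Measure.toTemperedDistribution_apply μ.variation f).trans (integral_of_phase_eq_one hμ f).symm

end Positive

end LocFinComplexMeasure

/-- A phase function: a `C¹` function on the line whose derivative is bounded and bounded away from
zero. The points of the measures below are the solutions of `Φ x ∈ c + ℤ`. -/
structure PhaseFunction where
  /-- The underlying function. -/
  toFun : ℝ → ℝ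
  contDiff_toFun : ContDiff ℝ 1 toFun
  exists_le_deriv : ∃ δ > 0, ∀ x, δ ≤ deriv toFun x
  exists_deriv_le : ∃ M, ∀ x, deriv toFun x ≤ M

namespace PhaseFunction

instance : CoeFun PhaseFunction fun _ => ℝ → ℝ := ⟨toFun⟩

variable (Φ : PhaseFunction)

theorem contDiff : ContDiff ℝ 1 Φ := Φ.contDiff_toFun

theorem differentiable : Differentiable ℝ Φ := Φ.contDiff.differentiable one_ne_zero

theorem deriv_pos (x : ℝ) : 0 < deriv Φ x :=
  let ⟨_, hδ, h⟩ := Φ.exists_le_deriv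
  hδ.trans_le (h x)

theorem strictMono : StrictMono Φ := strictMono_of_deriv_pos Φ.deriv_pos

theorem surjective : Function.Surjective Φ := by
  obtain ⟨δ, hδ, hle⟩ := Φ.exists_le_deriv
  have hsub : ∀ ⦃x y : ℝ⦄, x ≤ y → δ * (y - x) ≤ Φ y - Φ x :=
    mul_sub_le_image_sub_of_le_deriv Φ.differentiable hle
  refine Φ.contDiff.continuous.surjective
    (tendsto_atTop_mono' _ ?_ (tendsto_atTop_add_const_right _ (Φ 0)
      (tendsto_id.const_mul_atTop hδ)))
    (tendsto_atBot_mono' _ ?_ (tendsto_atBot_add_const_right _ (Φ 0)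
      (tendsto_id.const_mul_atBot hδ)))
  · filter_upwards [eventually_ge_atTop 0] with x hx
    simpa [le_sub_iff_add_le] using hsub hx
  · filter_upwards [eventually_le_atBot 0] with x hx
    have := hsub hx
    simp only [id]
    linarith

/-- The inverse of a phase function, as an order isomorphism of the line. -/
noncomputable def symm : ℝ ≃o ℝ := (Φ.strictMono.orderIsoOfSurjective Φ Φ.surjective).symm

@[simp]
theorem apply_symm_apply (y : ℝ) : Φ (Φ.symm y) = y :=
  (Φ.strictMono.orderIsoOfSurjective Φ Φ.surjective).apply_symm_apply y

@[simp]
theorem symm_apply_apply (x : ℝ) : Φ.symm (Φ x) = x :=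
  (Φ.strictMono.orderIsoOfSurjective Φ Φ.surjective).symm_apply_apply x

theorem tendsto_symm_cocompact : Tendsto Φ.symm (cocompact ℝ) (cocompact ℝ) :=
  Φ.symm.toHomeomorph.isClosedEmbedding.tendsto_cocompact

theorem contDiff_symm {n : WithTop ℕ∞} (h : ContDiff ℝ n Φ) : ContDiff ℝ n Φ.symm :=
  Φ.symm.symm.toHomeomorph.contDiff_symm_deriv (fun x => (Φ.deriv_pos x).ne')
    (fun x => (Φ.differentiable x).hasDerivAt) h

theorem differentiable_symm : Differentiable ℝ Φ.symm :=
  (Φ.contDiff_symm Φ.contDiff).differentiable one_ne_zero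

theorem deriv_symm (y : ℝ) : deriv Φ.symm y = (deriv Φ (Φ.symm y))⁻¹ :=
  (HasDerivAt.of_local_left_inverse Φ.symm.continuous.continuousAt
    (Φ.differentiable _).hasDerivAt (Φ.deriv_pos _).ne'
    (.of_forall Φ.apply_symm_apply)).deriv

theorem deriv_symm_pos (y : ℝ) : 0 < deriv Φ.symm y := by
  rw [deriv_symm]
  exact inv_pos.2 (Φ.deriv_pos _)

theorem exists_deriv_symm_le : ∃ C, ∀ y, deriv Φ.symm y ≤ C := by
  obtain ⟨δ, hδ, hle⟩ := Φ.exists_le_deriv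
  exact ⟨δ⁻¹, fun y => Φ.deriv_symm y ▸ inv_anti₀ hδ (hle _)⟩

theorem isBigO_id_symm : (fun y => y) =O[cocompact ℝ] Φ.symm := by
  obtain ⟨M, hM⟩ := Φ.exists_deriv_le
  have hlip : ∀ x, ‖Φ x - Φ 0‖ ≤ M * ‖x‖ := fun x => by
    simpa using Convex.norm_image_sub_le_of_norm_deriv_le (s := Set.univ) (C := M)
      (fun x _ => Φ.differentiable x)
      (fun x _ => (Real.norm_of_nonneg (Φ.deriv_pos x).le).trans_le (hM x))
      convex_univ (Set.mem_univ 0) (Set.mem_univ x)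
  have hΦ : Φ =O[cocompact ℝ] fun x => x := by
    have hconst : (fun _ : ℝ => Φ 0) =O[cocompact ℝ] fun x => x :=
      Metric.cobounded_eq_cocompact (α := ℝ) ▸ (Asymptotics.isLittleO_const_id_cobounded _).isBigO
    simpa using (Asymptotics.IsBigO.of_bound M (.of_forall hlip)).add hconst
  simpa [Function.comp_def] using hΦ.comp_tendsto Φ.tendsto_symm_cocompact

theorem isBigO_abs_symm_rpow_neg {b : ℝ} (hb : 0 ≤ b) :
    (fun y => |Φ.symm y| ^ (-b)) =O[cocompact ℝ] fun y => |y| ^ (-b) := by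
  have hne : ∀ᶠ y : ℝ in cocompact ℝ, y ≠ 0 :=
    Metric.cobounded_eq_cocompact (α := ℝ) ▸ Bornology.eventually_ne_cobounded 0
  have hpow : (fun y => |y| ^ b) =O[cocompact ℝ] fun y => |Φ.symm y| ^ b :=
    Φ.isBigO_id_symm.abs_abs.rpow hb (.of_forall fun _ => abs_nonneg _)
  simpa only [Real.rpow_neg (abs_nonneg _)] using
    hpow.inv_rev (hne.mono fun y hy h => absurd h (Real.rpow_pos_of_pos (abs_pos.2 hy) b).ne')

variable {Φ} in
theorem symm_add {a b : ℝ} (h : ∀ x, Φ (x + a) = Φ x + b) (y : ℝ) :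
    Φ.symm (y + b) = Φ.symm y + a := by
  rw [← Φ.symm_apply_apply (Φ.symm y + a), h, apply_symm_apply]

theorem injective_symm_add_intCast (c : ℝ) : Function.Injective fun j : ℤ => Φ.symm (c + j) :=
  Φ.symm.injective.comp ((add_right_injective c).comp Int.cast_injective)

/-- The points `x` with `Φ x ∈ c + ℤ`, each with the weight `1 / Φ' x`. -/
noncomputable def combWeight (c : ℝ) : ℝ → ℂ :=
  Function.extend (fun j : ℤ => Φ.symm (c + j)) (fun j => ((deriv Φ.symm (c + j) : ℝ) : ℂ)) 0

theorem support_combWeight (c : ℝ) :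
    Function.support (Φ.combWeight c) = Set.range fun j : ℤ => Φ.symm (c + j) := by
  rw [combWeight, Function.support_extend_zero (Φ.injective_symm_add_intCast c), ← Set.image_univ]
  congr 1
  ext j
  simpa using (Φ.deriv_symm_pos (c + j)).ne'

theorem isDiscreteClosed_range_symm_add_intCast (c : ℝ) :
    IsDiscreteClosed (Set.range fun j : ℤ => Φ.symm (c + j)) := by
  intro a b
  have hfin : ((fun j : ℤ => c + (j : ℝ)) ⁻¹' Set.Icc (Φ a) (Φ b)).Finite := by
    refine (Set.finite_Icc ⌈Φ a - c⌉ ⌊Φ b - c⌋).subset fun j hj => ?_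
    rw [Set.mem_preimage, Set.mem_Icc] at hj
    exact ⟨Int.ceil_le.2 (by linarith), Int.le_floor.2 (by linarith)⟩
  refine (hfin.image fun j : ℤ => Φ.symm (c + j)).subset ?_
  rintro _ ⟨⟨j, rfl⟩, h⟩
  refine ⟨j, ?_, rfl⟩
  rw [Set.mem_preimage, ← Φ.apply_symm_apply (c + j)]
  exact ⟨Φ.strictMono.monotone h.1, Φ.strictMono.monotone h.2⟩

/-- The pure point measure `∑ δ_x / Φ' x` over the solutions of `Φ x ∈ c + ℤ`. -/
noncomputable def comb (c : ℝ) : LocFinComplexMeasure :=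
  .ofAtoms (w := Φ.combWeight c) <| by
    rw [support_combWeight]
    exact Φ.isDiscreteClosed_range_symm_add_intCast c

theorem atoms_comb (c : ℝ) : (Φ.comb c).atoms = Set.range fun j : ℤ => Φ.symm (c + j) := by
  rw [comb, LocFinComplexMeasure.atoms_ofAtoms, support_combWeight]

open scoped ComplexOrder in
theorem phase_comb (c t : ℝ) : (Φ.comb c).phase t = 1 := by
  refine LocFinComplexMeasure.phase_ofAtoms_of_nonneg _ (fun s => ?_) t
  by_cases hs : ∃ j : ℤ, Φ.symm (c + j) = s
  · obtain ⟨j, rfl⟩ := hs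
    rw [combWeight, (Φ.injective_symm_add_intCast c).extend_apply]
    exact_mod_cast (Φ.deriv_symm_pos _).le
  · rw [combWeight, Function.extend_apply' _ _ _ hs]
    rfl

instance hasTemperateGrowth_variation_comb (c : ℝ) : (Φ.comb c).variation.HasTemperateGrowth := by
  have hinj := Φ.injective_symm_add_intCast c
  obtain ⟨C, hC⟩ := Φ.exists_deriv_symm_le
  have hbig : (fun x : ℝ => (1 + ‖x‖) ^ (-2 : ℝ)) =O[cocompact ℝ] fun x => |x| ^ (-2 : ℝ) := by
    have hne : ∀ᶠ x : ℝ in cocompact ℝ, x ≠ 0 :=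
      Metric.cobounded_eq_cocompact (α := ℝ) ▸ Bornology.eventually_ne_cobounded 0
    refine Asymptotics.IsBigO.of_bound 1 (hne.mono fun x hx => ?_)
    rw [one_mul, Real.norm_of_nonneg (by positivity),
      Real.norm_of_nonneg (r := |x| ^ (-2 : ℝ)) (by positivity)]
    exact Real.rpow_le_rpow_of_nonpos (abs_pos.2 hx) (by simp) (by norm_num)
  have hsum : Summable fun j : ℤ => (1 + ‖Φ.symm (c + j)‖) ^ (-2 : ℝ) := by
    refine summable_of_isBigO ((Real.summable_one_div_int_add_rpow c 2).2 one_lt_two) ?_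
    have hshift : Tendsto (fun j : ℤ => c + (j : ℝ)) cofinite (cocompact ℝ) :=
      (Homeomorph.addLeft c).isClosedEmbedding.tendsto_cocompact.comp Int.tendsto_coe_cofinite
    have := (((hbig.comp_tendsto Φ.tendsto_symm_cocompact).trans
      (Φ.isBigO_abs_symm_rpow_neg zero_le_two)).comp_tendsto hshift)
    simpa [Function.comp_def, add_comm, Real.rpow_neg] using this
  refine LocFinComplexMeasure.hasTemperateGrowth_variation_ofAtoms _ (n := 2) ?_
  rw [← hinj.summable_iff fun t ht => ?_]
  · refine (hsum.mul_left C).of_nonneg_of_le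
      (fun j => mul_nonneg (norm_nonneg _) (by positivity)) fun j => ?_
    rw [Function.comp_apply, combWeight, hinj.extend_apply, Complex.norm_real,
      Real.norm_of_nonneg (Φ.deriv_symm_pos _).le, Nat.cast_ofNat]
    gcongr
    exact hC _
  · rw [combWeight, Function.extend_apply' _ _ _ ht, Pi.zero_apply, norm_zero, zero_mul]

theorem integral_comb {c : ℝ} {f : ℝ → ℂ} (hf : Integrable f (Φ.comb c).variation) :
    (Φ.comb c).integral f = ∑' j : ℤ, f (Φ.symm (c + j)) * (deriv Φ.symm (c + j) : ℝ) := by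
  rw [comb, LocFinComplexMeasure.integral_ofAtoms _ hf, combWeight,
    tsum_mul_extend_zero (Φ.injective_symm_add_intCast c)]

theorem variation_comb_ne_zero (c : ℝ) : (Φ.comb c).variation ≠ 0 := by
  refine LocFinComplexMeasure.variation_ofAtoms_ne_zero _ (t := Φ.symm (c + (0 : ℤ))) ?_
  rw [← Function.mem_support, support_combWeight]
  exact ⟨0, rfl⟩

theorem isBigO_schwartz_comp_symm (f : 𝓢(ℝ, ℂ)) :
    (fun y => f (Φ.symm y) * (deriv Φ.symm y : ℝ)) =O[cocompact ℝ] fun y => |y| ^ (-2 : ℝ) := by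
  obtain ⟨C, hC⟩ := Φ.exists_deriv_symm_le
  have hderiv : (fun y => ((deriv Φ.symm y : ℝ) : ℂ)) =O[cocompact ℝ] fun _ => (1 : ℝ) := by
    refine Asymptotics.IsBigO.of_bound C (.of_forall fun y => ?_)
    simpa [abs_of_pos (Φ.deriv_symm_pos y)] using hC y
  simpa using (((f.isBigO_cocompact_rpow (-2)).comp_tendsto Φ.tendsto_symm_cocompact).trans
    (Φ.isBigO_abs_symm_rpow_neg zero_le_two)).mul hderiv

open Real in
theorem fourier_comp_symm_mul_deriv (f : ℝ → ℂ) (ξ : ℝ) :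
    𝓕 (fun y => f (Φ.symm y) * (deriv Φ.symm y : ℝ)) ξ = ∫ x, f x * 𝐞 (-(ξ * Φ x)) := by
  have hcov := integral_image_eq_integral_abs_deriv_smul (f := Φ.symm) MeasurableSet.univ
    (fun y _ => (Φ.differentiable_symm y).hasDerivAt.hasDerivWithinAt)
    Φ.symm.injective.injOn (fun x => f x * 𝐞 (-(ξ * Φ x)))
  rw [Set.image_univ, Φ.symm.surjective.range_eq] at hcov
  simp only [Measure.restrict_univ] at hcov
  rw [hcov, Real.fourier_real_eq]
  refine integral_congr_ae (.of_forall fun y => ?_)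
  simp only [apply_symm_apply, abs_of_pos (Φ.deriv_symm_pos y), Complex.real_smul, Circle.smul_def,
    smul_eq_mul, mul_comm ξ]
  ring

open Real in
theorem integral_comb_eq_tsum (f : 𝓢(ℝ, ℂ)) (c : ℝ)
    (hf : Summable fun n : ℤ => ∫ x, f x * 𝐞 (n * Φ x)) :
    (Φ.comb c).integral f = ∑' n : ℤ, (∫ x, f x * 𝐞 (n * Φ x)) * 𝐞 (-(n * c)) := by
  have hcont : Continuous fun y => f (Φ.symm y) * ((deriv Φ.symm y : ℝ) : ℂ) :=
    (f.continuous.comp Φ.symm.continuous).mul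
      (Complex.continuous_ofReal.comp ((Φ.contDiff_symm Φ.contDiff).continuous_deriv_one))
  have hfourier : ∀ n : ℤ, 𝓕 (fun y => f (Φ.symm y) * ((deriv Φ.symm y : ℝ) : ℂ)) n =
      ∫ x, f x * 𝐞 (((-n : ℤ) : ℝ) * Φ x) := fun n => by
    rw [fourier_comp_symm_mul_deriv]
    simp only [Int.cast_neg, neg_mul]
  rw [integral_comb _ f.integrable, Real.tsum_eq_tsum_fourier_of_rpow_decay_of_summable hcont
    one_lt_two (Φ.isBigO_schwartz_comp_symm f) ?_ c, ← (Equiv.neg ℤ).tsum_eq]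
  · refine tsum_congr fun n => ?_
    rw [hfourier, Equiv.neg_apply, neg_neg, fourier_coe_apply, Real.fourierChar_apply]
    push_cast
    ring_nf
  · simp only [hfourier]
    exact (Equiv.neg ℤ).summable_iff.2 hf

end PhaseFunction

section Expansion

open Real

theorem integral_fourier_mul_fourierChar (φ : 𝓢(ℝ, ℂ)) (ξ : ℝ) :
    ∫ x, 𝓕 φ x * 𝐞 (ξ * x) = φ ξ := by
  have hinv : 𝓕⁻ (𝓕 φ) ξ = φ ξ := by rw [FourierTransform.fourierInv_fourier_eq]
  rw [← hinv, SchwartzMap.fourierInv_coe, Real.fourierInv_eq]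
  simp only [Circle.smul_def, smul_eq_mul, RCLike.inner_apply, conj_trivial, mul_comm]

theorem integral_fourier_mul_tsum_fourierChar {ι : Type*} [Countable ι] (φ : 𝓢(ℝ, ℂ)) {a : ι → ℂ}
    (ha : Summable fun i => ‖a i‖) (ξ : ι → ℝ) :
    ∫ x, 𝓕 φ x * ∑' i, a i * 𝐞 (ξ i * x) = ∑' i, φ (ξ i) * a i := by
  have hint : ∀ i, Integrable fun x => 𝓕 φ x * 𝐞 (ξ i * x) * a i := fun i =>
    ((𝓕 φ).integrable.mul_bdd (c := 1)
      (Continuous.aestronglyMeasurable (by fun_prop))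
      (.of_forall fun x => (Circle.norm_coe _).le)).mul_const _
  have hsum := hasSum_integral_of_summable_integral_norm hint (by
    simp only [norm_mul, Circle.norm_coe, mul_one, integral_mul_const]
    exact ha.mul_left _)
  simp only [integral_mul_const, integral_fourier_mul_fourierChar] at hsum
  rw [hsum.tsum_eq]
  refine integral_congr_ae (.of_forall fun x => ?_)
  simp only [← tsum_mul_left]
  exact tsum_congr fun i => by ring

/-- The absolutely convergent expansion `𝐞(n Φ(x)) = ∑ₖ b k 𝐞((n θ + k) x)`, where only `k` of the
same sign as `n` occur. -/
structure HasPhaseExpansion (Φ : ℝ → ℝ) (θ : ℝ) (n : ℤ) (b : ℤ → ℂ) : Prop where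
  summable_norm : Summable fun k => ‖b k‖
  mul_nonneg : ∀ k, b k ≠ 0 → 0 ≤ n * k
  eq_tsum : ∀ x, (𝐞 (n * Φ x) : ℂ) = ∑' k : ℤ, b k * 𝐞 ((n * θ + k) * x)

theorem HasPhaseExpansion.neg {Φ : ℝ → ℝ} {θ : ℝ} {n : ℤ} {b : ℤ → ℂ}
    (h : HasPhaseExpansion Φ θ n b) :
    HasPhaseExpansion Φ θ (-n) fun k => (starRingEnd ℂ) (b (-k)) where
  summable_norm := by
    simpa [Function.comp_def] using (Equiv.neg ℤ).summable_iff.2 h.summable_norm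
  mul_nonneg k hk := by
    simpa using h.mul_nonneg (-k) (by simpa using hk)
  eq_tsum x := by
    have hconj : ∀ t : ℝ, (𝐞 (-t) : ℂ) = (starRingEnd ℂ) (𝐞 t) := fun t => by
      rw [AddChar.map_neg_eq_inv, Circle.coe_inv_eq_conj]
    rw [Int.cast_neg, neg_mul, hconj, h.eq_tsum, Complex.conj_tsum, ← (Equiv.neg ℤ).tsum_eq]
    refine tsum_congr fun k => ?_
    rw [map_mul, ← hconj, Equiv.neg_apply]
    push_cast
    ring_nf

theorem exists_summable_norm_hasSum_pow {F : ℂ → ℂ} {R : ℝ} (hR : 1 < R)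
    (hF : DifferentiableOn ℂ F (Metric.closedBall 0 R)) :
    ∃ c : ℕ → ℂ, Summable (fun k => ‖c k‖) ∧
      ∀ w : ℂ, ‖w‖ ≤ 1 → HasSum (fun k => c k * w ^ k) (F w) := by
  lift R to NNReal using zero_le_one.trans hR.le
  have hps := hF.hasFPowerSeriesOnBall (by exact_mod_cast zero_lt_one.trans hR)
  have hmem : ∀ w : ℂ, ‖w‖ ≤ 1 → w ∈ Metric.eball 0 (R : ENNReal) := fun w hw => by
    simpa using hw.trans_lt hR
  refine ⟨(cauchyPowerSeries F 0 R).coeff, ?_, fun w hw => ?_⟩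
  · exact FormalMultilinearSeries.summable_norm_apply _
      (Metric.eball_subset_eball hps.r_le (hmem 1 norm_one.le))
  · simpa [mul_comm] using hps.hasSum (hmem w hw)

theorem exists_hasPhaseExpansion_natCast {Φ : ℝ → ℝ} {θ R : ℝ} {F : ℂ → ℂ} (hR : 1 < R)
    (hF : DifferentiableOn ℂ F (Metric.closedBall 0 R))
    (hΦ : ∀ x, (𝐞 (Φ x) : ℂ) = 𝐞 (θ * x) * F (𝐞 x)) (n : ℕ) :
    ∃ b, HasPhaseExpansion Φ θ n b := by
  obtain ⟨c, hc, hsum⟩ := exists_summable_norm_hasSum_pow hR (hF.pow n)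
  have hinj : Function.Injective (Nat.cast : ℕ → ℤ) := Nat.cast_injective
  refine ⟨Function.extend Nat.cast c 0, ?_, fun k hk => ?_, fun x => ?_⟩
  · rw [← hinj.summable_iff fun k hk => ?_]
    · simpa [Function.comp_def, hinj.extend_apply] using hc
    · simp [Function.extend_apply' _ _ _ hk]
  · by_cases h : k ∈ Set.range (Nat.cast : ℕ → ℤ)
    · obtain ⟨m, rfl⟩ := h
      positivity
    · exact absurd (Function.extend_apply' _ _ _ h) hk
  · have hpow : ∀ (m : ℕ) (t : ℝ), (𝐞 (m * t) : ℂ) = 𝐞 t ^ m := fun m t => by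
      rw [← nsmul_eq_mul, AddChar.map_nsmul_eq_pow, Circle.coe_pow]
    calc (𝐞 ((n : ℤ) * Φ x) : ℂ) = 𝐞 (n * (θ * x)) * F (𝐞 x) ^ n := by
          rw [Int.cast_natCast, hpow, hΦ, mul_pow, hpow]
      _ = ∑' k : ℕ, 𝐞 (n * (θ * x)) * (c k * 𝐞 x ^ k) := by
          rw [tsum_mul_left]
          exact congrArg _ (hsum (𝐞 x) (Circle.norm_coe _).le).tsum_eq.symm
      _ = ∑' k : ℕ, Function.extend Nat.cast c 0 (k : ℤ) * 𝐞 ((n * θ + k) * x) := by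
          refine tsum_congr fun k => ?_
          rw [hinj.extend_apply, add_mul, AddChar.map_add_eq_mul, Circle.coe_mul, hpow k, mul_assoc]
          ring
      _ = ∑' k : ℤ, Function.extend Nat.cast c 0 k * 𝐞 (((n : ℤ) * θ + k) * x) := by
          refine hinj.tsum_eq (f := fun k : ℤ => Function.extend Nat.cast c 0 k *
            (𝐞 (((n : ℤ) * θ + k) * x) : ℂ)) fun k hk => ?_
          by_contra h
          exact left_ne_zero_of_mul hk (Function.extend_apply' _ _ _ h)

theorem exists_hasPhaseExpansion {Φ : ℝ → ℝ} {θ R : ℝ} {F : ℂ → ℂ} (hR : 1 < R)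
    (hF : DifferentiableOn ℂ F (Metric.closedBall 0 R))
    (hΦ : ∀ x, (𝐞 (Φ x) : ℂ) = 𝐞 (θ * x) * F (𝐞 x)) (n : ℤ) :
    ∃ b, HasPhaseExpansion Φ θ n b := by
  obtain ⟨m, rfl | rfl⟩ := n.eq_nat_or_neg
  · exact exists_hasPhaseExpansion_natCast hR hF hΦ m
  · obtain ⟨b, hb⟩ := exists_hasPhaseExpansion_natCast hR hF hΦ m
    exact ⟨_, hb.neg⟩

theorem finite_abs_intCast_mul_add_le {θ : ℝ} (hθ : 0 < θ) (R : ℝ) :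
    {p : ℤ × ℤ | 0 ≤ p.1 * p.2 ∧ |p.1 * θ + p.2| ≤ R}.Finite := by
  have hint : ∀ B : ℝ, {n : ℤ | |(n : ℝ)| ≤ B}.Finite := fun B => by
    refine (Set.finite_Icc ⌈-B⌉ ⌊B⌋).subset fun n hn => ?_
    exact ⟨Int.ceil_le.2 (abs_le.1 hn).1, Int.le_floor.2 (abs_le.1 hn).2⟩
  refine ((hint (R / θ)).prod (hint R)).subset ?_
  rintro ⟨n, k⟩ ⟨hnk, hR⟩
  have habs : |n * θ + k| = |(n : ℝ)| * θ + |(k : ℝ)| := by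
    rw [← abs_of_pos hθ, ← abs_mul, abs_of_pos hθ, abs_add_eq_add_abs_iff]
    rcases mul_nonneg_iff.1 hnk with ⟨hn, hk⟩ | ⟨hn, hk⟩
    · exact .inl ⟨mul_nonneg (by exact_mod_cast hn) hθ.le, by exact_mod_cast hk⟩
    · exact .inr ⟨mul_nonpos_of_nonpos_of_nonneg (by exact_mod_cast hn) hθ.le, by exact_mod_cast hk⟩
  have hn : 0 ≤ |(n : ℝ)| * θ := by positivity
  rw [habs] at hR
  exact ⟨(le_div_iff₀ hθ).2 (by linarith [abs_nonneg (k : ℝ)]), by simpa using by linarith⟩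

theorem injective_intCast_mul_add {θ : ℝ} (hθ : Irrational θ) :
    Function.Injective fun p : ℤ × ℤ => p.1 * θ + p.2 := by
  rintro ⟨n, k⟩ ⟨n', k'⟩ h
  have h' : ((n - n' : ℤ) : ℝ) * θ = (k' - k : ℤ) := by
    push_cast
    linear_combination h
  have hn : n - n' = 0 := by
    by_contra hne
    exact (hθ.intCast_mul hne).ne_int _ h'
  rw [hn, Int.cast_zero, zero_mul, eq_comm, Int.cast_eq_zero] at h'
  rw [sub_eq_zero.1 hn, sub_eq_zero.1 h']

variable {Φ : ℝ → ℝ} {θ : ℝ} {b : ℤ → ℤ → ℂ}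

theorem finite_phaseExpansion_frequencies_inter (hθ : 0 < θ)
    (hb : ∀ n, HasPhaseExpansion Φ θ n (b n)) {s : Set ℝ} (hs : Bornology.IsBounded s) :
    {p : ℤ × ℤ | b p.1 p.2 ≠ 0 ∧ p.1 * θ + p.2 ∈ s}.Finite := by
  obtain ⟨R, hR⟩ := hs.subset_closedBall 0
  refine (finite_abs_intCast_mul_add_le hθ R).subset fun p hp => ?_
  exact ⟨(hb p.1).mul_nonneg _ hp.1, mem_closedBall_zero_iff.1 (hR hp.2)⟩

/-- The function on the line with the value `b n k * 𝐞(-n c)` at each frequency `n θ + k`. It is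
well defined for irrational `θ`. -/
noncomputable def spectrumWeight (θ : ℝ) (b : ℤ → ℤ → ℂ) (c : ℝ) : ℝ → ℂ :=
  Function.extend (fun p : ℤ × ℤ => p.1 * θ + p.2) (fun p => b p.1 p.2 * 𝐞 (-(p.1 * c))) 0

theorem isDiscreteClosed_support_spectrumWeight (hθ : 0 < θ) (hθ' : Irrational θ)
    (hb : ∀ n, HasPhaseExpansion Φ θ n (b n)) (c : ℝ) :
    IsDiscreteClosed (Function.support (spectrumWeight θ b c)) := by
  intro s t
  refine ((finite_phaseExpansion_frequencies_inter hθ hb (Metric.isBounded_Icc s t)).image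
    fun p => p.1 * θ + p.2).subset ?_
  rw [spectrumWeight, Function.support_extend_zero (injective_intCast_mul_add hθ')]
  rintro _ ⟨⟨p, hp, rfl⟩, hst⟩
  exact ⟨p, ⟨left_ne_zero_of_mul hp, hst⟩, rfl⟩

namespace PhaseFunction

theorem isDistribution_fourier_comb (Φ : PhaseFunction) (hθ : 0 < θ) (hθ' : Irrational θ)
    (hb : ∀ n, HasPhaseExpansion Φ θ n (b n)) (c : ℝ) :
    (LocFinComplexMeasure.ofAtoms
      (isDiscreteClosed_support_spectrumWeight hθ hθ' hb c)).IsDistribution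
      (𝓕 (Φ.comb c).variation.toTemperedDistribution) := by
  intro φ hφ
  have hfin : {p : ℤ × ℤ | φ (p.1 * θ + p.2) * b p.1 p.2 ≠ 0}.Finite :=
    (finite_phaseExpansion_frequencies_inter hθ hb hφ.isCompact.isBounded).subset fun p hp =>
      ⟨right_ne_zero_of_mul hp, subset_tsupport _ (left_ne_zero_of_mul hp)⟩
  have hcoeff : ∀ n : ℤ, ∫ x, 𝓕 φ x * 𝐞 (n * Φ x) = ∑' k : ℤ, φ (n * θ + k) * b n k := fun n => by
    simp only [(hb n).eq_tsum]
    exact integral_fourier_mul_tsum_fourierChar φ (hb n).summable_norm _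
  have hsum₁ : Summable fun n : ℤ => ∫ x, 𝓕 φ x * 𝐞 (n * Φ x) := by
    refine summable_of_hasFiniteSupport ((hfin.image Prod.fst).subset fun n hn => ?_)
    rw [Function.mem_support, hcoeff] at hn
    by_contra hn'
    exact hn ((tsum_congr fun k => not_not.1 fun hk => hn' ⟨(n, k), hk, rfl⟩).trans tsum_zero)
  have hsum₂ : Summable fun p : ℤ × ℤ => φ (p.1 * θ + p.2) * (b p.1 p.2 * 𝐞 (-(p.1 * c))) := by
    refine summable_of_hasFiniteSupport (hfin.subset fun p hp => ?_)
    rw [Function.mem_support, ← mul_assoc] at hp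
    exact left_ne_zero_of_mul hp
  calc 𝓕 (Φ.comb c).variation.toTemperedDistribution φ = (Φ.comb c).integral ⇑(𝓕 φ : 𝓢(ℝ, ℂ)) := by
        rw [TemperedDistribution.fourier_apply,
          LocFinComplexMeasure.integral_of_phase_eq_one (Φ.phase_comb c)]
        exact Measure.toTemperedDistribution_apply (Φ.comb c).variation (𝓕 φ)
    _ = ∑' n : ℤ, ∑' k : ℤ, φ (n * θ + k) * (b n k * 𝐞 (-(n * c))) := by
        rw [Φ.integral_comb_eq_tsum _ c hsum₁]
        simp only [hcoeff, ← tsum_mul_right, mul_assoc]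
    _ = ∑' p : ℤ × ℤ, φ (p.1 * θ + p.2) * (b p.1 p.2 * 𝐞 (-(p.1 * c))) := hsum₂.tsum_prod.symm
    _ = _ := by
        rw [LocFinComplexMeasure.integral_ofAtoms_of_hasCompactSupport _ φ.continuous hφ,
          spectrumWeight, tsum_mul_extend_zero (injective_intCast_mul_add hθ')]

end PhaseFunction

end Expansion

section Blaschke

open Real

theorem cexp_two_mul_arctan (t : ℝ) :
    Complex.exp (2 * Real.arctan t * Complex.I) =
      (1 + t * Complex.I) / (1 - t * Complex.I) := by
  have h₁ : 1 + (t : ℂ) * Complex.I ≠ 0 := fun h => by simpa using congrArg Complex.re h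
  have h₂ : 1 - (t : ℂ) * Complex.I ≠ 0 := fun h => by simpa using congrArg Complex.re h
  have h : 2 * Complex.arctan t * Complex.I =
      Complex.log ((1 + t * Complex.I) / (1 - t * Complex.I)) := by
    rw [Complex.arctan]
    linear_combination
      -Complex.log ((1 + t * Complex.I) / (1 - t * Complex.I)) * Complex.I_sq
  rw [Complex.ofReal_arctan, h, Complex.exp_log (div_ne_zero h₁ h₂)]

/-- A lift to the line, along `𝐞`, of the product of the character `𝐞 (θ x)` and of the Blaschke
factor `(w - r) / (1 - r w)` at `w = 𝐞 x`. -/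
noncomputable def blaschkeLift (θ r x : ℝ) : ℝ :=
  (θ + 1) * x +
    Real.arctan (r * Real.sin (2 * π * x) / (1 - r * Real.cos (2 * π * x))) / π

variable {θ r : ℝ}

theorem mul_cos_le_abs (r x : ℝ) : r * Real.cos x ≤ |r| :=
  (le_abs_self _).trans <| by
    rw [abs_mul]
    exact mul_le_of_le_one_right (abs_nonneg r) (Real.abs_cos_le_one x)

theorem sq_one_sub_abs_le (r x : ℝ) : (1 - |r|) ^ 2 ≤ 1 - 2 * r * Real.cos x + r ^ 2 := by
  linear_combination 2 * mul_cos_le_abs r x + sq_abs r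

theorem one_sub_mul_cos_pos (hr : |r| < 1) (x : ℝ) : 0 < 1 - r * Real.cos x :=
  sub_pos.2 ((mul_cos_le_abs r x).trans_lt hr)

theorem contDiff_blaschkeLift (hr : |r| < 1) {n : WithTop ℕ∞} :
    ContDiff ℝ n (blaschkeLift θ r) := by
  have hl : ContDiff ℝ n (fun x : ℝ => 2 * π * x) := by fun_prop
  exact (contDiff_const.mul contDiff_id).add ((Real.contDiff_arctan.comp
    ((contDiff_const.mul (Real.contDiff_sin.comp hl)).div
      (contDiff_const.sub (contDiff_const.mul (Real.contDiff_cos.comp hl)))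
      fun x => (one_sub_mul_cos_pos hr _).ne')).div_const _)

theorem blaschkeLift_add_one (θ r x : ℝ) :
    blaschkeLift θ r (x + 1) = blaschkeLift θ r x + (θ + 1) := by
  simp only [blaschkeLift, mul_add (2 * π) x 1, mul_one, Real.sin_add_two_pi, Real.cos_add_two_pi]
  ring

theorem deriv_blaschkeLift (hr : |r| < 1) (x : ℝ) :
    deriv (blaschkeLift θ r) x =
      θ + (1 - r ^ 2) / (1 - 2 * r * Real.cos (2 * π * x) + r ^ 2) := by
  have h₁ := (one_sub_mul_cos_pos hr (2 * π * x)).ne'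
  have h₂ : 1 - 2 * r * Real.cos (2 * π * x) + r ^ 2 ≠ 0 :=
    ((pow_pos (sub_pos.2 hr) 2).trans_le (sq_one_sub_abs_le r _)).ne'
  have hl : HasDerivAt (fun x : ℝ => 2 * π * x) (2 * π) x := by
    simpa using (hasDerivAt_id x).const_mul (2 * π)
  have h := ((hasDerivAt_id x).const_mul (θ + 1)).add
    ((((hl.sin.const_mul r).div ((hl.cos.const_mul r).const_sub 1) h₁).arctan).div_const π)
  refine (HasDerivAt.congr_deriv (f' := _) h ?_).deriv
  have hsc := Real.sin_sq_add_cos_sq (2 * π * x)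
  simp only [Pi.div_apply]
  set c := Real.cos (2 * π * x)
  set s := Real.sin (2 * π * x)
  have hden : 1 + (r * s / (1 - r * c)) ^ 2 = (1 - 2 * r * c + r ^ 2) / (1 - r * c) ^ 2 := by
    field_simp
    linear_combination r ^ 2 * hsc
  rw [hden]
  field_simp
  linear_combination -2 * r ^ 2 * hsc

theorem le_deriv_blaschkeLift (hr : |r| < 1) (x : ℝ) : θ ≤ deriv (blaschkeLift θ r) x := by
  rw [deriv_blaschkeLift hr, le_add_iff_nonneg_right]
  exact div_nonneg (sub_nonneg.2 ((sq_lt_one_iff_abs_lt_one r).2 hr).le)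
    ((sq_nonneg _).trans (sq_one_sub_abs_le r _))

theorem deriv_blaschkeLift_le (hr : |r| < 1) (x : ℝ) :
    deriv (blaschkeLift θ r) x ≤ θ + 1 / (1 - |r|) ^ 2 := by
  rw [deriv_blaschkeLift hr]
  gcongr
  · exact sub_le_self _ (sq_nonneg r)
  · exact sq_one_sub_abs_le r _

theorem deriv_blaschkeLift_zero_ne (hr : |r| < 1) (hr₀ : r ≠ 0) :
    deriv (blaschkeLift θ r) 0 ≠ deriv (blaschkeLift θ r) (1 / 2) := by
  have h₁ : 1 - r ≠ 0 := fun h => by simp [← sub_eq_zero.1 h] at hr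
  have h₂ : 1 + r ≠ 0 := fun h => by simp [eq_neg_of_add_eq_zero_right h] at hr
  have hπ : 2 * π * (1 / 2) = π := by ring
  rw [deriv_blaschkeLift hr, deriv_blaschkeLift hr, hπ, mul_zero, Real.cos_zero, Real.cos_pi]
  intro h
  have e₁ : 1 - 2 * r * 1 + r ^ 2 = (1 - r) ^ 2 := by ring
  have e₂ : 1 - 2 * r * -1 + r ^ 2 = (1 + r) ^ 2 := by ring
  have e₃ : 1 - r ^ 2 = (1 - r) * (1 + r) := by ring
  rw [e₁, e₂, e₃] at h
  field_simp at h
  apply hr₀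
  linear_combination h / 4

theorem fourierChar_blaschkeLift (hr : |r| < 1) (x : ℝ) :
    (𝐞 (blaschkeLift θ r x) : ℂ) = 𝐞 (θ * x) * ((𝐞 x - r) / (1 - r * 𝐞 x)) := by
  have hc : (1 : ℂ) - r * Real.cos (2 * π * x) ≠ 0 := by
    exact_mod_cast (one_sub_mul_cos_pos hr (2 * π * x)).ne'
  have hsc : (Real.sin (2 * π * x) : ℂ) ^ 2 + (Real.cos (2 * π * x) : ℂ) ^ 2 = 1 := by
    exact_mod_cast Real.sin_sq_add_cos_sq (2 * π * x)
  have hw : (𝐞 x : ℂ) = Real.cos (2 * π * x) + Real.sin (2 * π * x) * Complex.I := by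
    rw [Real.fourierChar_apply, Complex.exp_ofReal_mul_I]
  have hsplit : (𝐞 (blaschkeLift θ r x) : ℂ) = 𝐞 (θ * x) * (𝐞 x * Complex.exp
      (2 * (Real.arctan (r * Real.sin (2 * π * x) / (1 - r * Real.cos (2 * π * x))) : ℂ) *
        Complex.I)) := by
    simp only [Real.fourierChar_apply, ← Complex.exp_add, blaschkeLift]
    congr 1
    push_cast
    field_simp
    ring
  rw [hsplit, cexp_two_mul_arctan, hw]
  simp only [Complex.ofReal_div, Complex.ofReal_mul, Complex.ofReal_sub, Complex.ofReal_one]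
  congr 1
  generalize (Real.cos (2 * π * x) : ℂ) = c at *
  generalize (Real.sin (2 * π * x) : ℂ) = s at *
  have e₁ : (1 + r * s / (1 - r * c) * Complex.I) / (1 - r * s / (1 - r * c) * Complex.I) =
      (1 - r * c + r * s * Complex.I) / (1 - r * c - r * s * Complex.I) := by
    rw [← mul_div_mul_left _ _ hc]
    congr 1 <;> field_simp
  rw [e₁, mul_div_assoc']
  congr 1
  · linear_combination r * s ^ 2 * Complex.I_sq - r * hsc
  · ring

theorem exists_hasPhaseExpansion_blaschkeLift (hr : |r| < 1) (θ : ℝ) (n : ℤ) :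
    ∃ b, HasPhaseExpansion (blaschkeLift θ r) θ n b := by
  have hpos : 0 < 1 + |r| := by positivity
  refine exists_hasPhaseExpansion (R := 2 / (1 + |r|))
    (F := fun w => (w - r) / (1 - r * w)) ((one_lt_div hpos).2 (by linarith)) ?_
    (fourierChar_blaschkeLift hr) n
  have hnum : DifferentiableOn ℂ (fun w : ℂ => w - r) (Metric.closedBall 0 (2 / (1 + |r|))) := by
    fun_prop
  refine hnum.div (by fun_prop) fun w hw h => ?_
  have hlt : ‖(r : ℂ) * w‖ < 1 := calc
    ‖(r : ℂ) * w‖ ≤ |r| * (2 / (1 + |r|)) := by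
      rw [norm_mul, Complex.norm_real, Real.norm_eq_abs]
      gcongr
      exact mem_closedBall_zero_iff.1 hw
    _ < 1 := by
      rw [mul_div_assoc', div_lt_one hpos]
      linarith
  simp [← sub_eq_zero.1 h] at hlt

/-- The phase function given by `blaschkeLift`. -/
noncomputable def blaschkePhase (hθ : 0 < θ) (hr : |r| < 1) : PhaseFunction where
  toFun := blaschkeLift θ r
  contDiff_toFun := contDiff_blaschkeLift hr
  exists_le_deriv := ⟨θ, hθ, le_deriv_blaschkeLift hr⟩
  exists_deriv_le := ⟨_, deriv_blaschkeLift_le hr⟩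

end Blaschke

section Genericity

open scoped ContDiff

theorem eq_of_periodic_of_meanValue {g : ℝ → ℝ} {τ a b t : ℝ} (hg : Continuous g)
    (hper : Function.Periodic g τ) (hτ : 0 < τ) (hb : Irrational (b / τ)) (ht₀ : 0 ≤ t)
    (ht₁ : t < 1) (h : ∀ y, g y = t * g (y + a) + (1 - t) * g (y + b)) (y z : ℝ) : g y = g z := by
  have : Fact (0 < τ) := ⟨hτ⟩
  obtain ⟨_, ⟨y₀, rfl⟩, hmax⟩ :=
    (hper.compact_of_continuous hτ.ne' hg).exists_isGreatest (Set.range_nonempty g)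
  replace hmax : ∀ y, g y ≤ g y₀ := fun y => hmax ⟨y, rfl⟩
  have hstep : ∀ y, g y = g y₀ → g (y + b) = g y₀ := fun y hy => by
    refine (hmax _).antisymm (le_of_mul_le_mul_left ?_ (sub_pos.2 ht₁))
    linarith [h y, mul_le_mul_of_nonneg_left (hmax (y + a)) ht₀]
  have horbit : ∀ n : ℕ, g (y₀ + n • b) = g y₀ := fun n => by
    induction n with
    | zero => simp
    | succ n ih => rw [succ_nsmul, ← add_assoc, hstep _ ih]
  have hdense : DenseRange fun n : ℕ => n • (b : AddCircle τ) :=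
    denseRange_zsmul_iff_nsmul.1 (AddCircle.denseRange_zsmul_coe_iff.2 hb)
  have hlift : Continuous hper.lift := continuous_coinduced_dom.2 hg
  have hconst : (fun s : AddCircle τ => hper.lift (y₀ + s)) = fun _ => g y₀ :=
    hdense.equalizer (by fun_prop) continuous_const (funext horbit)
  have hall : ∀ y, g y = g y₀ := fun y => by
    simpa [← AddCircle.coe_add] using congrFun hconst ((y - y₀ : ℝ) : AddCircle τ)
  rw [hall y, hall z]

theorem countable_setOf_eq_zero_of_contDiff {f : ℝ → ℝ} (hf : ContDiff ℝ ω f) {y : ℝ}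
    (hy : f y ≠ 0) : {x | f x = 0}.Countable := by
  have hd : IsDiscrete (f ⁻¹' {0} ∩ Set.univ) :=
    isDiscrete_of_codiscreteWithin (hf.analyticOnNhd.preimage_zero_mem_codiscrete hy)
  rw [Set.inter_univ] at hd
  exact (HereditarilyLindelofSpace.isLindelof _).countable_of_isDiscrete hd

/-- No point of `A` is a rational convex combination of two other points of `A`. -/
def RatConvexFree (A : Set ℝ) : Prop :=
  ∀ x ∈ A, ∀ y ∈ A, ∀ z ∈ A, x < y → y < z → ∀ t : ℚ, y ≠ t * x + (1 - t) * z

namespace PhaseFunction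

variable {Φ : PhaseFunction} {a τ : ℝ}

theorem deriv_eq_of_symm_eq (hper : ∀ x, Φ (x + a) = Φ x + τ) (hτ : 0 < τ) {u v t : ℝ}
    (hu : u < 0) (hv : 0 < v) (hvτ : Irrational (v / τ))
    (h : ∀ y, Φ.symm y = t * Φ.symm (y + u) + (1 - t) * Φ.symm (y + v)) (x₁ x₂ : ℝ) :
    deriv Φ x₁ = deriv Φ x₂ := by
  have hlt₁ : Φ.symm (0 + u) < Φ.symm 0 := Φ.symm.strictMono (by linarith)
  have hlt₂ : Φ.symm 0 < Φ.symm (0 + v) := Φ.symm.strictMono (by linarith)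
  have ht₀ : 0 ≤ t := by
    refine le_of_mul_le_mul_right ?_ (hlt₁.trans hlt₂ |> sub_pos.2)
    linarith [h 0]
  have ht₁ : t < 1 := by
    refine lt_of_mul_lt_mul_right ?_ (hlt₁.trans hlt₂ |> sub_pos.2).le
    linarith [h 0]
  have hshift : ∀ w, Differentiable ℝ fun y => Φ.symm (y + w) := fun w =>
    Φ.differentiable_symm.comp (differentiable_id.add_const w)
  have hmean : ∀ y, deriv Φ.symm y =
      t * deriv Φ.symm (y + u) + (1 - t) * deriv Φ.symm (y + v) := fun y => by
    conv_lhs => rw [funext h]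
    rw [deriv_fun_add ((hshift u y).const_mul t) ((hshift v y).const_mul _),
      deriv_const_mul_field, deriv_const_mul_field, deriv_comp_add_const, deriv_comp_add_const]
  have hperiodic : Function.Periodic (deriv Φ.symm) τ := fun y => by
    rw [← deriv_comp_add_const, funext (Φ.symm_add hper), deriv_add_const]
  have hconst := eq_of_periodic_of_meanValue
    ((Φ.contDiff_symm Φ.contDiff).continuous_deriv le_rfl) hperiodic hτ hvτ ht₀ ht₁ hmean
    (Φ x₁) (Φ x₂)
  rwa [Φ.deriv_symm, Φ.deriv_symm, Φ.symm_apply_apply, Φ.symm_apply_apply, inv_inj] at hconst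

theorem countable_setOf_symm_eq (hΦ : ContDiff ℝ ω Φ) (hper : ∀ x, Φ (x + a) = Φ x + τ)
    (hτ : 0 < τ) (hτ' : Irrational τ) {x₁ x₂ : ℝ} (hne : deriv Φ x₁ ≠ deriv Φ x₂) {i j k : ℤ}
    (hij : i < j) (hjk : j < k) (t : ℝ) :
    {c : ℝ | Φ.symm (c + j) = t * Φ.symm (c + i) + (1 - t) * Φ.symm (c + k)}.Countable := by
  have hshift : ∀ n : ℤ, ContDiff ℝ ω fun c : ℝ => Φ.symm (c + n) := fun n =>
    (Φ.contDiff_symm hΦ).comp (contDiff_id.add contDiff_const)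
  have hdiff : ContDiff ℝ ω fun c : ℝ =>
      Φ.symm (c + j) - (t * Φ.symm (c + i) + (1 - t) * Φ.symm (c + k)) :=
    (hshift j).sub ((contDiff_const.mul (hshift i)).add (contDiff_const.mul (hshift k)))
  simp only [← sub_eq_zero (a := Φ.symm _)]
  by_contra hunc
  have hzero : ∀ c, Φ.symm (c + j) - (t * Φ.symm (c + i) + (1 - t) * Φ.symm (c + k)) = 0 :=
    fun c => not_not.1 fun hc => hunc (countable_setOf_eq_zero_of_contDiff hdiff hc)
  refine hne (deriv_eq_of_symm_eq hper hτ (t := t) (u := (i - j : ℤ)) (v := (k - j : ℤ))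
    (by exact_mod_cast sub_neg.2 hij) (by exact_mod_cast sub_pos.2 hjk)
    (hτ'.intCast_div (sub_pos.2 hjk).ne') (fun y => ?_) x₁ x₂)
  simpa [sub_eq_zero, sub_add_eq_add_sub, add_sub_assoc] using hzero (y - j)

theorem exists_ratConvexFree_range (hΦ : ContDiff ℝ ω Φ) (hper : ∀ x, Φ (x + a) = Φ x + τ)
    (hτ : 0 < τ) (hτ' : Irrational τ) {x₁ x₂ : ℝ} (hne : deriv Φ x₁ ≠ deriv Φ x₂) :
    ∃ c : ℝ, RatConvexFree (Set.range fun j : ℤ => Φ.symm (c + j)) := by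
  let bad : ℤ × ℤ × ℤ × ℚ → Set ℝ := fun p => {c | p.1 < p.2.1 ∧ p.2.1 < p.2.2.1 ∧
    Φ.symm (c + p.2.1) = p.2.2.2 * Φ.symm (c + p.1) + (1 - p.2.2.2) * Φ.symm (c + p.2.2.1)}
  have hbad : (⋃ p, bad p).Countable := Set.countable_iUnion fun ⟨i, j, k, t⟩ => by
    by_cases h : i < j ∧ j < k
    · exact (countable_setOf_symm_eq hΦ hper hτ hτ' hne h.1 h.2 t).mono fun c hc => hc.2.2
    · exact (Set.countable_empty).mono fun c hc => h ⟨hc.1, hc.2.1⟩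
  obtain ⟨c, hc⟩ := hbad.dense_compl ℝ |>.nonempty
  refine ⟨c, ?_⟩
  rintro _ ⟨i, rfl⟩ _ ⟨j, rfl⟩ _ ⟨k, rfl⟩ hij hjk t h
  simp only [OrderIso.lt_iff_lt, add_lt_add_iff_left, Int.cast_lt] at hij hjk
  exact hc (Set.mem_iUnion.2 ⟨(i, j, k, t), hij, hjk, h⟩)

end PhaseFunction

theorem RatConvexFree.finite_inter_arithProg {A : Set ℝ} (hA : RatConvexFree A) (a d : ℝ) :
    (A ∩ arithProg a d).Finite := by
  by_contra hinf
  obtain ⟨s, hs, hcard⟩ := Set.Infinite.exists_subset_card_eq hinf 3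
  let e := s.orderEmbOfFin hcard
  have he : ∀ i, e i ∈ A ∩ arithProg a d := fun i => hs (s.orderEmbOfFin_mem hcard i)
  obtain ⟨h₀, l, hl : a + l * d = e 0⟩ := he 0
  obtain ⟨h₁, m, hm : a + m * d = e 1⟩ := he 1
  obtain ⟨h₂, n, hn : a + n * d = e 2⟩ := he 2
  have h₀₁ : e 0 < e 1 := e.strictMono (by decide)
  have h₁₂ : e 1 < e 2 := e.strictMono (by decide)
  have hln : (n : ℝ) - l ≠ 0 := fun h => by
    have : (n - l : ℝ) * d = e 2 - e 0 := by rw [← hl, ← hn]; ring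
    rw [h] at this
    linarith
  refine hA _ h₀ _ h₁ _ h₂ h₀₁ h₁₂ ((n - m) / (n - l)) ?_
  rw [← hl, ← hm, ← hn]
  push_cast
  field_simp
  ring

theorem not_subset_biUnion_arithProg {A : Set ℝ} (hA : A.Infinite)
    (h : ∀ a d, (A ∩ arithProg a d).Finite) (d : ℝ) (F : Finset ℝ) :
    ¬ A ⊆ ⋃ a ∈ F, arithProg a d := fun hsub => by
  refine hA ((F.finite_toSet.biUnion fun a _ => h a d).subset fun x hx => ?_)
  simpa [hx] using hsub hx

end Genericity

theorem theorem1 :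
    ∃ (μ ν : LocFinComplexMeasure) (T : 𝓢'(ℝ, ℂ)),
      μ.variation ≠ 0 ∧ μ.IsReal ∧
      μ.IsPurePoint ∧ μ.IsDistribution T ∧
      ν.IsPurePoint ∧ ν.IsDistribution (𝓕 T) ∧
      IsDiscreteClosed μ.atoms ∧ IsDiscreteClosed ν.atoms ∧
      (∀ a d : ℝ, (μ.atoms ∩ arithProg a d).Finite) ∧
      (∀ (d : ℝ) (F : Finset ℝ), ¬ μ.atoms ⊆ ⋃ a ∈ F, arithProg a d) := by
  have hθ : 0 < √2 := by positivity
  have hr : |(1 / 2 : ℝ)| < 1 := by norm_num [abs_of_pos]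
  let Φ : PhaseFunction := blaschkePhase hθ hr
  choose b hb using exists_hasPhaseExpansion_blaschkeLift hr √2
  obtain ⟨c, hc⟩ := PhaseFunction.exists_ratConvexFree_range (Φ := Φ) (contDiff_blaschkeLift hr)
    (blaschkeLift_add_one √2 (1 / 2)) (by positivity)
    (by simpa using irrational_sqrt_two.add_natCast 1)
    (deriv_blaschkeLift_zero_ne hr one_half_pos.ne')
  have hS := isDiscreteClosed_support_spectrumWeight hθ irrational_sqrt_two hb c
  have hinf := Set.infinite_range_of_injective (Φ.injective_symm_add_intCast c)
  rw [← Φ.atoms_comb] at hc hinf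
  exact ⟨Φ.comb c, .ofAtoms hS, (Φ.comb c).variation.toTemperedDistribution,
    Φ.variation_comb_ne_zero c,
    LocFinComplexMeasure.isReal_of_phase_eq_one (Φ.phase_comb c),
    LocFinComplexMeasure.isPurePoint_ofAtoms _,
    LocFinComplexMeasure.isDistribution_of_phase_eq_one (Φ.phase_comb c),
    LocFinComplexMeasure.isPurePoint_ofAtoms hS,
    Φ.isDistribution_fourier_comb hθ irrational_sqrt_two hb c,
    Φ.atoms_comb c ▸ Φ.isDiscreteClosed_range_symm_add_intCast c,
    (LocFinComplexMeasure.atoms_ofAtoms hS).symm ▸ hS,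
    hc.finite_inter_arithProg,
    not_subset_biUnion_arithProg hinf hc.finite_inter_arithProg⟩
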